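/- **Setting.** A *sparse signal* of length $T$ with support size $k$ ($1\le k<T$) is a random vector $(s[1],\dots,s[T])$ in $\mathbb R^T$ which almost surely has at most $k$ non-zero entries and whose entries have finite second moments. A *scalar quantizer* $Q$ with resolution $l+1$ ($l\ge 1$) is a measurable map $\mathbb R\to\{0,\dots,l\}$ followed by an assignment of an output value $q_j\in\mathbb R$ to each index $j$; the indices are labelled so that the input $0$ has index $0$, i.e. $Q(0)=q_0$. Put $$D_T(l)=\frac1T\sum_{i=1}^T\mathbb E\big[|s[i]-Q(s[i])|^2\big].$$ The *serial quantization system* with $b$ bits works as follows. * *Codebook:* $T\cdot l$ codewords $c_{j,i}\in\{0,1\}^b$ ($1\le j\le l$, $1\le i\le T$) are drawn with i.i.d. Bernoulli bits of mean $\frac{\ln 2}{k}$, independently of the signal. The $i$-th bin is $\{c_{1,i},\dots,c_{l,i}\}$ together with the all-zero codeword $c_{0,i}=0$. * *Encoder:* a $b$-bit register starts at $0$. At time $i$ it is replaced by its Boolean OR with $c_{j,i}$, where $j$ is the index of the quantized sample $Q(s[i])$. The register content after time $T$ is the encoder output. * *Maximum likelihood decoder:* given the encoder output, it selects $k$ bins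 and one codeword $c_{j_i,i}$ in each of them such that the encoder output has maximal conditional probability given these codewords (ties are broken arbitrarily). It outputs $\hat s[i]=q_{j_i}$ for the selected bins and $\hat s[i]=q_0$ for the others. Its MSE is $\frac1T\sum_{i=1}^T\mathbb E\big[|s[i]-\hat s[i]|^2\big]$, the expectation being over the signal and the codebook. **Corollary.** The system approaches the MSE $D_T(l)$ as $T$ grows with a number of bits $b=\mathcal O(k\log T+k\log l)$, logarithmic in the signal length and linear in the sparsity. Precisely: there are a constant $C$ and a function $b(T,k,l)\in\mathbb N$ with $$b(T,k,l)\le C\,(k\log_2T+k\log_2 l)\qquad(T\ge2,\ k\ge1,\ l\ge1)$$ such that for all reals $P$, $A$ and every $\eta>0$ there is a $T_0$ with the following property. Let $T\ge T_0$, $1\le k<T$, $l\ge1$, let $Q$ be any scalar quantizer with resolution $l+1$ and outputs $|q_j|\le A$, and let $s$ be any sparse signal of length $T$ with support size $k$ and average power $\frac1T\sum_{i=1}^T\mathbb E[s[i]^2]\le P$. Then the system with any number $b\ge b(T,k,l)$ of bits and any maximum likelihood decoder satisfies $$\Pr\big(\exists i:\ \hat s[i]\ne Q(s[i])\big)\le\eta\qquad\text{and}\qquad\left|\frac1T\sum_{i=1}^T\mathbb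 E\big[|s[i]-\hat s[i]|^2\big]-D_T(l)\right|\le\frac{\eta}{T}.$$ -/

import Mathlib

open MeasureTheory ProbabilityTheory

noncomputable section

namespace SQuaTS

/-- A scalar quantizer on `ℝ` with resolution `l + 1`: a (measurable) encoding map into the
`l + 1` indices and a decoding map giving the `l + 1` output values `q_0, …, q_l`. The indices are
labelled so that the input `0` has index `0`, i.e. `Q(0) = q_0`. -/
structure ScalarQuantizer (l : ℕ) where
  enc : ℝ → Fin (l + 1)
  measurable_enc : Measurable enc
  enc_zero : enc 0 = 0
  level : Fin (l + 1) → ℝ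

/-- The quantization mapping `Q : ℝ → ℝ`. -/
def ScalarQuantizer.quantize {l : ℕ} (Q : ScalarQuantizer l) (x : ℝ) : ℝ :=
  Q.level (Q.enc x)

/-- The `b · T · l` random bits of the codebook: `cb r (i, j)` is the bit number `r` of the
codeword `c_{j+1, i}`, the `(j+1)`-st codeword of the bin of the time instance `i`. -/
abbrev Codebook (T l b : ℕ) : Type := Fin b → Fin T × Fin l → Bool

/-- The codeword `c_{j,i}` of the bin `i`; for `j = 0` it is the all-zero codeword, which is
contained in every bin. -/
def codeword {T l b : ℕ} (cb : Codebook T l b) (i : Fin T) (j : Fin (l + 1)) : Fin b → Bool :=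
  fun r => Fin.cases false (fun j' => cb r (i, j')) j

theorem bitMean_mem (k : ℕ) : Real.log 2 / (k : ℝ) ∈ unitInterval := by
  have h0 : 0 ≤ Real.log 2 := Real.log_nonneg (by norm_num)
  have h1 : Real.log 2 ≤ 1 := by linarith [Real.log_two_lt_d9]
  refine ⟨by positivity, ?_⟩
  rcases Nat.eq_zero_or_pos k with rfl | hk
  · simp
  · have hk' : (1 : ℝ) ≤ k := by exact_mod_cast hk
    rw [div_le_one (by linarith)]
    linarith

/-- The mean `ln 2 / k` of the codebook bits. -/
def bitMean (k : ℕ) : unitInterval := ⟨Real.log 2 / (k : ℝ), bitMean_mem k⟩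

/-- The law of the random codebook: all bits are i.i.d. Bernoulli with mean `ln 2 / k`. -/
def codebookLaw (T k l b : ℕ) : Measure (Codebook T l b) :=
  Measure.pi fun _ => Measure.pi fun _ => bernoulliMeasure true false (bitMean k)

/-- The content of the `b`-bit register after the first `n` time instances: it starts at zero and
is replaced at each time instance by its Boolean OR with the codeword that the bin of this time
instance assigns to the index of the quantized sample. -/
def register {T l b : ℕ} (Q : ScalarQuantizer l) (cb : Codebook T l b) (s : Fin T → ℝ) :
    ℕ → Fin b → Bool
  | 0 => fun _ => false
  | n + 1 => if h : n < T then
      (fun r => register Q cb s n r || codeword cb ⟨n, h⟩ (Q.enc (s ⟨n, h⟩)) r)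
    else register Q cb s n

/-- The encoder output: the register after all `T` samples. -/
def encode {T l b : ℕ} (Q : ScalarQuantizer l) (cb : Codebook T l b) (s : Fin T → ℝ) :
    Fin b → Bool :=
  register Q cb s T

/-- A collection of `k` codewords, each taken from a separate bin: the set of the `k` bins and the
choice of an index in each of them (the values of `index` outside `support` play no role). -/
structure Candidate (T k l : ℕ) where
  support : Finset (Fin T)
  card_support : support.card = k
  index : Fin T → Fin (l + 1)

/-- The Boolean OR of the codewords of a candidate. -/
def Candidate.orWord {T k l b : ℕ} (w : Candidate T k l) (cb : Codebook T l b) : Fin b → Bool :=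
  w.support.sup fun i => codeword cb i (w.index i)

/-- The likelihood `Pr(y | w)` of the encoder output `y`, given that the selected codewords are
those of the candidate `w` (and the zero codeword in all the other bins). As the encoder is
deterministic, this conditional law is the point mass at the Boolean OR of the codewords. -/
def likelihood {T k l b : ℕ} (cb : Codebook T l b) (y : Fin b → Bool) (w : Candidate T k l) :
    ENNReal :=
  PMF.pure (w.orWord cb) y

/-- `dec` is a maximum likelihood decoder (ties may be broken in any way): for each codebook and
each encoder output it selects a candidate of maximal likelihood. -/
def IsMLDecoder {T k l b : ℕ} (dec : Codebook T l b → (Fin b → Bool) → Candidate T k l) : Prop :=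
  ∀ (cb : Codebook T l b) (y : Fin b → Bool) (w : Candidate T k l),
    likelihood cb y w ≤ likelihood cb y (dec cb y)

/-- The digital representation given by a candidate: `q_{j_i}` for the time instances `i` in its
support and `q_0` for the others. -/
def Candidate.reconstruct {T k l : ℕ} (w : Candidate T k l) (Q : ScalarQuantizer l) :
    Fin T → ℝ :=
  fun i => if i ∈ w.support then Q.level (w.index i) else Q.level 0

/-- The output of the whole system for the codebook `cb` and the input signal `s`. -/
def output {T k l b : ℕ} (Q : ScalarQuantizer l)
    (dec : Codebook T l b → (Fin b → Bool) → Candidate T k l)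
    (cb : Codebook T l b) (s : Fin T → ℝ) : Fin T → ℝ :=
  (dec cb (encode Q cb s)).reconstruct Q

/-- The average MSE `D_T(l)` of the scalar quantizer applied directly to each sample, where `μ` is
the law of the signal `(s[1], …, s[T])`. -/
def scalarMSE {T l : ℕ} (Q : ScalarQuantizer l) (μ : Measure (Fin T → ℝ)) : ℝ :=
  (1 / (T : ℝ)) * ∑ i, ∫ s, |s i - Q.quantize (s i)| ^ 2 ∂μ

/-- The MSE of the system; the random codebook is independent of the signal. -/
def systemMSE {T k l b : ℕ} (Q : ScalarQuantizer l) (μ : Measure (Fin T → ℝ))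
    (dec : Codebook T l b → (Fin b → Bool) → Candidate T k l) : ℝ :=
  ∫ x, (1 / (T : ℝ)) * ∑ i, |x.2 i - output Q dec x.1 x.2 i| ^ 2 ∂((codebookLaw T k l b).prod μ)

/-- The probability that the system does not output exactly the quantized samples
`Q(s[1]), …, Q(s[T])`. -/
def errorProb {T k l b : ℕ} (Q : ScalarQuantizer l) (μ : Measure (Fin T → ℝ))
    (dec : Codebook T l b → (Fin b → Bool) → Candidate T k l) : ℝ :=
  ((codebookLaw T k l b).prod μ).real
    {x | ∃ i, output Q dec x.1 x.2 i ≠ Q.quantize (x.2 i)}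

end SQuaTS

end

/-! Fix the signal and let `x` be its index map. Bit `r` of the output is the OR of bit `r` over the
non-zero codewords used by `x`. The likelihood takes only the values 0 and 1, and `x` itself comes
from a candidate. So the decoder errs only if some `y ≠ x` with at most `k` non-zero indices has the
same OR in all `b` bits (`exists_collision`).

If `x` and `y` differ in `n` places, one bit fails to separate them with probability at most `1 -
n/(20k)` (`rowLaw_real_sameOr_le`). Bits are independent, so a collision has probability at most `ρ
^ n` with `ρ = exp (-b/(20k))`. Summing over all `y`, sparse or not, the Hamming distance factorizes
over coordinates (`sum_pow_card_ne`), and the error probability is at most `(1 + lρ)^T - 1`. For `b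
≥ 60 k (log₂ T + log₂ l)` this is at most `2/T²`.

The bound holds conditionally on the signal, so the two MSEs differ by at most `2/T²` times a
constant depending on `P` and `A`, hence by at most `η/T` for large `T`. -/

noncomputable section

namespace SQuaTS

variable {T k l b : ℕ}

/-! ### Encoder and decoder in terms of index maps -/

/-- The non-zero codewords selected by the index map `x`. -/
def usedWords (x : Fin T → Fin (l + 1)) : Finset (Fin T × Fin l) :=
  Finset.univ.filter fun c => x c.1 = c.2.succ

theorem mem_usedWords {x : Fin T → Fin (l + 1)} {c : Fin T × Fin l} :
    c ∈ usedWords x ↔ x c.1 = c.2.succ := by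
  simp [usedWords]

theorem codeword_zero (cb : Codebook T l b) (i : Fin T) (r : Fin b) :
    codeword cb i 0 r = false := rfl

theorem codeword_succ (cb : Codebook T l b) (i : Fin T) (j : Fin l) (r : Fin b) :
    codeword cb i j.succ r = cb r (i, j) := rfl

theorem exists_codeword_iff (cb : Codebook T l b) (x : Fin T → Fin (l + 1)) (r : Fin b) :
    (∃ i, codeword cb i (x i) r = true) ↔ ∃ c ∈ usedWords x, cb r c = true := by
  constructor
  · rintro ⟨i, hi⟩
    rcases Fin.eq_zero_or_eq_succ (x i) with h | ⟨j, h⟩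
    · rw [h, codeword_zero] at hi
      exact absurd hi (by simp)
    · rw [h, codeword_succ] at hi
      exact ⟨(i, j), mem_usedWords.2 h, hi⟩
  · rintro ⟨⟨i, j⟩, hc, h⟩
    refine ⟨i, ?_⟩
    rw [mem_usedWords.1 hc, codeword_succ]
    exact h

theorem register_eq_true_iff (Q : ScalarQuantizer l) (cb : Codebook T l b) (s : Fin T → ℝ)
    (r : Fin b) (n : ℕ) :
    register Q cb s n r = true ↔ ∃ i : Fin T, i.1 < n ∧ codeword cb i (Q.enc (s i)) r = true := by
  induction n with
  | zero => simp [register]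
  | succ n ih =>
    rw [register]
    split_ifs with h
    · rw [Bool.or_eq_true, ih]
      constructor
      · rintro (⟨i, hi, h'⟩ | h')
        · exact ⟨i, by omega, h'⟩
        · exact ⟨⟨n, h⟩, Nat.lt_succ_self n, h'⟩
      · rintro ⟨i, hi, h'⟩
        rcases Nat.lt_succ_iff_lt_or_eq.1 hi with h1 | h1
        · exact Or.inl ⟨i, h1, h'⟩
        · obtain rfl : i = ⟨n, h⟩ := Fin.ext h1
          exact Or.inr h'
    · rw [ih]
      constructor
      · rintro ⟨i, hi, h'⟩
        exact ⟨i, by omega, h'⟩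
      · rintro ⟨i, hi, h'⟩
        exact ⟨i, by omega, h'⟩

theorem encode_eq_true_iff (Q : ScalarQuantizer l) (cb : Codebook T l b) (s : Fin T → ℝ)
    (r : Fin b) :
    encode Q cb s r = true ↔ ∃ c ∈ usedWords (fun i => Q.enc (s i)), cb r c = true := by
  rw [encode, register_eq_true_iff, ← exists_codeword_iff]
  exact exists_congr fun i => by simp [i.2]

/-- The index map of a candidate, with index `0` outside the selected bins. -/
def Candidate.indexMap (w : Candidate T k l) : Fin T → Fin (l + 1) :=
  fun i => if i ∈ w.support then w.index i else 0

theorem Candidate.reconstruct_apply (w : Candidate T k l) (Q : ScalarQuantizer l) (i : Fin T) :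
    w.reconstruct Q i = Q.level (w.indexMap i) := by
  simp only [reconstruct, indexMap]
  split_ifs <;> rfl

theorem Candidate.card_indexMap_ne_zero_le (w : Candidate T k l) :
    (Finset.univ.filter fun i => w.indexMap i ≠ 0).card ≤ k := by
  refine le_of_le_of_eq (Finset.card_le_card fun i hi => ?_) w.card_support
  by_contra h
  exact (Finset.mem_filter.1 hi).2 (if_neg h)

theorem finset_sup_apply_eq_true_iff {ι α : Type*} (S : Finset ι) (f : ι → α → Bool) (r : α) :
    S.sup f r = true ↔ ∃ i ∈ S, f i r = true := by
  classical
  induction S using Finset.induction_on with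
  | empty => simp
  | insert a S _ ih => simp [Finset.sup_insert, ← ih]

theorem Candidate.orWord_eq_true_iff (w : Candidate T k l) (cb : Codebook T l b) (r : Fin b) :
    w.orWord cb r = true ↔ ∃ c ∈ usedWords w.indexMap, cb r c = true := by
  rw [Candidate.orWord, finset_sup_apply_eq_true_iff, ← exists_codeword_iff]
  refine exists_congr fun i => ?_
  by_cases h : i ∈ w.support <;> simp [Candidate.indexMap, h, codeword_zero]

theorem likelihood_eq_one {cb : Codebook T l b} {y : Fin b → Bool} {w : Candidate T k l}
    (h : y = w.orWord cb) : likelihood cb y w = 1 := by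
  simp [likelihood, h]

theorem eq_orWord_of_one_le_likelihood {cb : Codebook T l b} {y : Fin b → Bool}
    {w : Candidate T k l} (h : 1 ≤ likelihood cb y w) : y = w.orWord cb := by
  by_contra hne
  simp [likelihood, PMF.pure_apply, hne] at h

/-- Every index map with at most `k` non-zero indices comes from a candidate. -/
theorem exists_candidate_indexMap_eq (hkT : k ≤ T) (x : Fin T → Fin (l + 1))
    (hx : (Finset.univ.filter fun i => x i ≠ 0).card ≤ k) :
    ∃ w : Candidate T k l, w.indexMap = x := by
  -- A candidate has exactly `k` bins; the surplus ones carry index 0, whose codeword is zero.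
  obtain ⟨S, hS, hcard⟩ := Finset.exists_superset_card_eq hx (by simpa using hkT)
  refine ⟨⟨S, hcard, x⟩, funext fun i => ?_⟩
  simp only [Candidate.indexMap]
  split_ifs with h
  · rfl
  · by_contra hne
    exact h (hS (Finset.mem_filter.2 ⟨Finset.mem_univ i, fun h0 => hne h0.symm⟩))

theorem card_enc_ne_zero_le (Q : ScalarQuantizer l) {s : Fin T → ℝ}
    (hs : {i | s i ≠ 0}.ncard ≤ k) :
    (Finset.univ.filter fun i => Q.enc (s i) ≠ 0).card ≤ k := by
  refine le_trans ?_ hs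
  rw [← Set.ncard_coe_finset]
  refine Set.ncard_le_ncard (fun i hi h0 => ?_) (Set.toFinite _)
  simp only [Finset.coe_filter, Set.mem_ofPred_eq] at hi
  exact hi.2 (by rw [h0, Q.enc_zero])

/-- The two sets of codewords have the same Boolean OR in the given bit. -/
def SameOr {ι : Type*} (A B : Finset ι) (row : ι → Bool) : Prop :=
  (∃ c ∈ A, row c = true) ↔ ∃ c ∈ B, row c = true

/-- A wrong output of a maximum likelihood decoder is caused by a collision of the codebook. -/
theorem exists_collision {Q : ScalarQuantizer l}
    {dec : Codebook T l b → (Fin b → Bool) → Candidate T k l} (hdec : IsMLDecoder dec)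
    (hkT : k ≤ T) {cb : Codebook T l b} {s : Fin T → ℝ} (hs : {i | s i ≠ 0}.ncard ≤ k)
    (hne : ∃ i, output Q dec cb s i ≠ Q.quantize (s i)) :
    ∃ y : Fin T → Fin (l + 1), (Finset.univ.filter fun i => y i ≠ 0).card ≤ k ∧
      y ≠ (fun i => Q.enc (s i)) ∧
      ∀ r, SameOr (usedWords y) (usedWords fun i => Q.enc (s i)) (cb r) := by
  refine ⟨(dec cb (encode Q cb s)).indexMap, Candidate.card_indexMap_ne_zero_le _, ?_, ?_⟩
  · obtain ⟨i, hi⟩ := hne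
    intro h
    apply hi
    rw [output, Candidate.reconstruct_apply, h]
    rfl
  -- The true index map has likelihood 1, so the decoder's choice does too and reproduces the
  -- output.
  · obtain ⟨w, hw⟩ := exists_candidate_indexMap_eq hkT (fun i => Q.enc (s i)) 
      (card_enc_ne_zero_le Q hs)
    have hw1 : encode Q cb s = w.orWord cb := by
      funext r
      rw [Bool.eq_iff_iff, encode_eq_true_iff, Candidate.orWord_eq_true_iff, hw]
    have h1 := hdec cb (encode Q cb s) w
    rw [likelihood_eq_one hw1] at h1
    have h2 := eq_orWord_of_one_le_likelihood h1
    intro r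
    rw [SameOr, ← Candidate.orWord_eq_true_iff, ← encode_eq_true_iff, ← h2]

/-! ### The probability of a collision -/

/-- The law of one row of the codebook: the bits at a fixed position of all the codewords. -/
def rowLaw (k : ℕ) (ι : Type*) [Fintype ι] : Measure (ι → Bool) :=
  Measure.pi fun _ => bernoulliMeasure true false (bitMean k)

instance {ι : Type*} [Fintype ι] : IsProbabilityMeasure (rowLaw k ι) := by
  unfold rowLaw; infer_instance

theorem codebookLaw_eq : codebookLaw T k l b = Measure.pi fun _ => rowLaw k (Fin T × Fin l) := rfl

instance : IsProbabilityMeasure (codebookLaw T k l b) := by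
  rw [codebookLaw_eq]; infer_instance

theorem rowLaw_real_forall_eq_false {ι : Type*} [Fintype ι] (k : ℕ) (S : Finset ι) :
    (rowLaw k ι).real {row | ∀ c ∈ S, row c = false} = (1 - Real.log 2 / k) ^ S.card := by
  classical
  have h : {row : ι → Bool | ∀ c ∈ S, row c = false} =
      Set.univ.pi fun c => if c ∈ S then {false} else Set.univ := by
    ext row
    simp only [Set.mem_ofPred_eq, Set.mem_univ_pi]
    refine forall_congr' fun c => ?_
    by_cases hc : c ∈ S <;> simp [hc]
  have hB : (bernoulliMeasure true false (bitMean k)).real {false} = 1 - Real.log 2 / k := by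
    rw [bernoulliMeasure_real_apply _ (MeasurableSet.singleton _)]
    simp [bitMean]
  rw [h, measureReal_def, rowLaw, Measure.pi_pi, ENNReal.toReal_prod, Finset.card_eq_sum_ones,
    ← Finset.prod_pow_eq_pow_sum, ← Finset.prod_subset (Finset.subset_univ S)]
  · refine Finset.prod_congr rfl fun c hc => ?_
    rw [if_pos hc, pow_one, ← hB, measureReal_def]
  · intro c _ hc
    simp [hc]

/-- The ORs differ when `A` is all zero and `B \ A` is not; these two events are independent because
the sets are disjoint. -/
theorem le_rowLaw_real_not_sameOr {ι : Type*} [Fintype ι] [DecidableEq ι] (k : ℕ)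
    (A B : Finset ι) :
    (1 - Real.log 2 / k) ^ A.card * (1 - (1 - Real.log 2 / k) ^ (B \ A).card) ≤
      (rowLaw k ι).real {row | ¬ SameOr A B row} := by
  have h1 : {row : ι → Bool | ∀ c ∈ A, row c = false} ⊆
      {row | ∀ c ∈ A ∪ (B \ A), row c = false} ∪ {row | ¬ SameOr A B row} := by
    intro row hrow
    by_cases h : ∀ c ∈ B, row c = false
    · left
      intro c hc
      rcases Finset.mem_union.1 hc with hc | hc
      · exact hrow c hc
      · exact h c (Finset.mem_sdiff.1 hc).1
    · right
      push Not at h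
      obtain ⟨c, hc, hcr⟩ := h
      intro hsame
      obtain ⟨c', hc', h'⟩ := hsame.2 ⟨c, hc, by simpa using hcr⟩
      rw [hrow c' hc'] at h'
      exact absurd h' (by simp)
  have h2 := (measureReal_mono (μ := rowLaw k ι) h1).trans (measureReal_union_le _ _)
  rw [rowLaw_real_forall_eq_false, rowLaw_real_forall_eq_false,
    Finset.card_union_of_disjoint Finset.disjoint_sdiff, pow_add] at h2
  linarith

theorem sameOr_comm {ι : Type*} {A B : Finset ι} {row : ι → Bool} :
    SameOr A B row ↔ SameOr B A row := Iff.comm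

/-- Bernoulli's inequality for `1 + p` gives `(1 - p)^d ≤ 1 / (1 + dp)`, which is at most `1 - dp/2`
when `dp ≤ 1`. -/
theorem half_mul_le_one_sub_pow {p : ℝ} (hp : 0 ≤ p) (hp1 : p ≤ 1) (d : ℕ) (hd : d * p ≤ 1) :
    d * p / 2 ≤ 1 - (1 - p) ^ d := by
  have h1 : 1 + d * p ≤ (1 + p) ^ d := one_add_mul_le_pow (by linarith) d
  have h2 : (1 - p) ^ d * (1 + p) ^ d ≤ 1 := by
    rw [← mul_pow]
    exact pow_le_one₀ (by nlinarith) (by nlinarith)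
  have h3 : 0 ≤ (1 - p) ^ d := pow_nonneg (by linarith) d
  have h4 : (0 : ℝ) ≤ d * p := by positivity
  nlinarith [mul_le_mul_of_nonneg_left h1 h3]

theorem rowLaw_real_sameOr_le_of_card_le {ι : Type*} [Fintype ι] [DecidableEq ι] {k : ℕ}
    (hk : 1 ≤ k) {A B : Finset ι} (hA : A.card ≤ k) (hB : B.card ≤ k) {n : ℕ}
    (hn : n ≤ 2 * (B \ A).card) :
    (rowLaw k ι).real {row | SameOr A B row} ≤ 1 - n / (20 * k) := by
  have hk0 : (1 : ℝ) ≤ k := by exact_mod_cast hk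
  have hk1 : (k : ℝ) ≠ 0 := by linarith
  obtain ⟨hp0, hp1⟩ := bitMean_mem k
  have hkp : k * (Real.log 2 / k) = Real.log 2 := by field_simp
  have hl1 := Real.log_two_gt_d9
  have hl2 := Real.log_two_lt_d9
  have h := le_rowLaw_real_not_sameOr (k := k) A B
  have hd : ((B \ A).card : ℝ) ≤ k := by
    exact_mod_cast (Finset.card_le_card Finset.sdiff_subset).trans hB
  have hn' : (n : ℝ) ≤ 2 * (B \ A).card := by exact_mod_cast hn
  -- Bernoulli's inequality with exponent `k ≥ A.card` gives the lower bound `1 - log 2 > 3/10`.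
  have hq : (3 / 10 : ℝ) ≤ (1 - Real.log 2 / k) ^ A.card := by
    have h1 := one_add_mul_le_pow (a := -(Real.log 2 / k)) (by linarith) k
    have h2 := pow_le_pow_of_le_one (a := 1 - Real.log 2 / k) (by linarith) (by linarith) hA
    rw [← sub_eq_add_neg] at h1
    linarith
  have hhalf := half_mul_le_one_sub_pow hp0 hp1 (B \ A).card
    ((mul_le_mul_of_nonneg_right hd hp0).trans (by linarith))
  have hdp : (n : ℝ) / k * (693 / 1000) ≤ 2 * ((B \ A).card * (Real.log 2 / k)) := by
    have h1 : (n : ℝ) / k * (693 / 1000) ≤ (n : ℝ) / k * Real.log 2 :=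
      mul_le_mul_of_nonneg_left (by linarith) (by positivity)
    have h2 : (n : ℝ) / k * Real.log 2 = n * (Real.log 2 / k) := by ring
    nlinarith [mul_le_mul_of_nonneg_right hn' hp0]
  -- The constant 20 comes from `0.3 * 0.693 / 4 > 1/20`.
  have hprod : (3 / 10 : ℝ) * ((B \ A).card * (Real.log 2 / k) / 2) ≤
      (1 - Real.log 2 / k) ^ A.card * (1 - (1 - Real.log 2 / k) ^ (B \ A).card) :=
    mul_le_mul hq hhalf (by positivity) (by linarith)
  have hcompl := probReal_add_probReal_compl (μ := rowLaw k ι)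
    (s := {row | SameOr A B row}) (Set.toFinite _).measurableSet
  have hc : {row : ι → Bool | SameOr A B row}ᶜ = {row | ¬ SameOr A B row} := rfl
  rw [hc] at hcompl
  have hnk : (n : ℝ) / (20 * k) = n / k / 20 := by rw [div_div, mul_comm]
  have : 0 ≤ (n : ℝ) / k := by positivity
  rw [hnk]
  linarith

/-- The larger of the two differences has at least `n/2` elements, and the event is symmetric in `A`
and `B`. -/
theorem rowLaw_real_sameOr_le {ι : Type*} [Fintype ι] [DecidableEq ι] {k : ℕ}
    (hk : 1 ≤ k) {A B : Finset ι} (hA : A.card ≤ k) (hB : B.card ≤ k) {n : ℕ}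
    (hn : n ≤ (A \ B).card + (B \ A).card) :
    (rowLaw k ι).real {row | SameOr A B row} ≤ 1 - n / (20 * k) := by
  rcases le_total (A \ B).card (B \ A).card with h | h
  · exact rowLaw_real_sameOr_le_of_card_le hk hA hB (by omega)
  · simp only [sameOr_comm (A := A)]
    exact rowLaw_real_sameOr_le_of_card_le hk hB hA (by omega)

theorem card_usedWords_le (x : Fin T → Fin (l + 1)) :
    (usedWords x).card ≤ (Finset.univ.filter fun i => x i ≠ 0).card := by
  refine Finset.card_le_card_of_injOn Prod.fst (fun c hc => ?_) ?_
  · have := mem_usedWords.1 hc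
    simp [this]
  · rintro ⟨i, j⟩ hc ⟨i', j'⟩ hc' rfl
    have h1 := mem_usedWords.1 hc
    have h2 := mem_usedWords.1 hc'
    simp only at h1 h2
    rw [h1] at h2
    rw [Fin.succ_injective _ h2]

/-- Where the maps differ, one index is non-zero, and its codeword is used by that map only. -/
theorem card_ne_le_card_usedWords_sdiff (x y : Fin T → Fin (l + 1)) :
    (Finset.univ.filter fun i => x i ≠ y i).card ≤
      (usedWords x \ usedWords y).card + (usedWords y \ usedWords x).card := by
  refine le_trans (Finset.card_le_card fun i hi => ?_) ((Finset.card_image_le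
    (s := (usedWords x \ usedWords y) ∪ (usedWords y \ usedWords x)) (f := Prod.fst)).trans
    (Finset.card_union_le _ _))
  have hne := (Finset.mem_filter.1 hi).2
  rcases Fin.eq_zero_or_eq_succ (x i) with h | ⟨j, h⟩
  · rcases Fin.eq_zero_or_eq_succ (y i) with h' | ⟨j, h'⟩
    · exact absurd (h.trans h'.symm) hne
    · refine Finset.mem_image.2 ⟨(i, j), Finset.mem_union_right _ (Finset.mem_sdiff.2
        ⟨mem_usedWords.2 h', fun hx => hne ?_⟩), rfl⟩
      exact (mem_usedWords.1 hx).trans h'.symm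
  · refine Finset.mem_image.2 ⟨(i, j), Finset.mem_union_left _ (Finset.mem_sdiff.2
      ⟨mem_usedWords.2 h, fun hy => hne ?_⟩), rfl⟩
    exact h.trans (mem_usedWords.1 hy).symm

theorem codebookLaw_real_forall (G : Set (Fin T × Fin l → Bool)) :
    (codebookLaw T k l b).real {cb | ∀ r, cb r ∈ G} =
      ((rowLaw k (Fin T × Fin l)).real G) ^ b := by
  have h : {cb : Codebook T l b | ∀ r, cb r ∈ G} = Set.univ.pi fun _ => G := by
    ext cb; simp
  rw [h, measureReal_def, codebookLaw_eq, Measure.pi_pi]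
  simp [measureReal_def]

/-- The probability that two given index maps have the same encoder output. -/
theorem codebookLaw_real_sameOr_le (hk : 1 ≤ k) {x y : Fin T → Fin (l + 1)}
    (hx : (Finset.univ.filter fun i => x i ≠ 0).card ≤ k)
    (hy : (Finset.univ.filter fun i => y i ≠ 0).card ≤ k) :
    (codebookLaw T k l b).real {cb | ∀ r, SameOr (usedWords y) (usedWords x) (cb r)} ≤
      Real.exp (-(b / (20 * k))) ^ (Finset.univ.filter fun i => y i ≠ x i).card := by
  have h1 := rowLaw_real_sameOr_le hk ((card_usedWords_le y).trans hy)
    ((card_usedWords_le x).trans hx) (card_ne_le_card_usedWords_sdiff y x)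
  refine (codebookLaw_real_forall {row | SameOr (usedWords y) (usedWords x) row}).trans_le ?_
  set n := (Finset.univ.filter fun i => y i ≠ x i).card
  refine (pow_le_pow_left₀ measureReal_nonneg
    (h1.trans (Real.one_sub_le_exp_neg _)) b).trans_eq ?_
  rw [← Real.exp_nat_mul, ← Real.exp_nat_mul]
  congr 1
  ring

/-- The summand is a product over coordinates, each with one way to agree and `l` ways to differ. -/
theorem sum_pow_card_ne (x : Fin T → Fin (l + 1)) (ρ : ℝ) :
    ∑ y : Fin T → Fin (l + 1), ρ ^ (Finset.univ.filter fun i => y i ≠ x i).card =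
      (1 + l * ρ) ^ T := by
  have h1 : ∀ y : Fin T → Fin (l + 1),
      ρ ^ (Finset.univ.filter fun i => y i ≠ x i).card =
        ∏ i, if y i ≠ x i then ρ else 1 := fun y => by
    rw [Finset.prod_ite, Finset.prod_const, Finset.prod_const_one, mul_one]
  have h2 : ∀ i, ∑ j : Fin (l + 1), (if j ≠ x i then ρ else 1) = 1 + l * ρ := fun i => by
    rw [← Finset.add_sum_erase _ _ (Finset.mem_univ (x i))]
    rw [if_neg (by simp), Finset.sum_congr rfl (g := fun _ => ρ)
      (fun j hj => if_pos (Finset.ne_of_mem_erase hj))]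
    simp
  have h3 := Finset.prod_univ_sum (fun _ : Fin T => (Finset.univ : Finset (Fin (l + 1))))
    (fun i j => if j ≠ x i then ρ else 1)
  simp only [h2, Finset.prod_const, Finset.card_univ, Fintype.card_fin,
    Fintype.piFinset_univ] at h3
  rw [h3]
  exact Finset.sum_congr rfl fun y _ => h1 y

/-- Union bound over all the competing index maps. -/
theorem codebookLaw_real_output_ne_le (hk : 1 ≤ k) (hkT : k ≤ T) (Q : ScalarQuantizer l)
    {dec : Codebook T l b → (Fin b → Bool) → Candidate T k l} (hdec : IsMLDecoder dec)
    {s : Fin T → ℝ} (hs : {i | s i ≠ 0}.ncard ≤ k) :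
    (codebookLaw T k l b).real {cb | ∃ i, output Q dec cb s i ≠ Q.quantize (s i)} ≤
      (1 + l * Real.exp (-(b / (20 * k)))) ^ T - 1 := by
  set x : Fin T → Fin (l + 1) := fun i => Q.enc (s i)
  have hx : (Finset.univ.filter fun i => x i ≠ 0).card ≤ k := card_enc_ne_zero_le Q hs
  set S : Finset (Fin T → Fin (l + 1)) :=
    Finset.univ.filter fun y => (Finset.univ.filter fun i => y i ≠ 0).card ≤ k ∧ y ≠ x
  have hsub : {cb : Codebook T l b | ∃ i, output Q dec cb s i ≠ Q.quantize (s i)} ⊆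
      ⋃ y ∈ S, {cb | ∀ r, SameOr (usedWords y) (usedWords x) (cb r)} := by
    intro cb hcb
    obtain ⟨y, h1, h2, h3⟩ := exists_collision hdec hkT hs hcb
    exact Set.mem_biUnion (Finset.mem_coe.2 (Finset.mem_filter.2 ⟨Finset.mem_univ y, h1, h2⟩)) h3
  have hS' : S ⊆ Finset.univ.erase x := fun y hy =>
    Finset.mem_erase.2 ⟨(Finset.mem_filter.1 hy).2.2, Finset.mem_univ y⟩
  set ρ := Real.exp (-(b / (20 * k)))
  have hρ : 0 ≤ ρ := (Real.exp_pos _).le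
  calc _ ≤ _ := measureReal_mono hsub (measure_ne_top _ _)
    _ ≤ _ := measureReal_biUnion_finset_le _ _
    _ ≤ ∑ y ∈ S, ρ ^ (Finset.univ.filter fun i => y i ≠ x i).card :=
        Finset.sum_le_sum fun y hy => codebookLaw_real_sameOr_le hk hx (Finset.mem_filter.1 hy).2.1
    -- Sparsity of `y` is dropped here to get a closed form; omitting `y = x` accounts for the `-
    -- 1`.
    _ ≤ ∑ y ∈ Finset.univ.erase x, ρ ^ (Finset.univ.filter fun i => y i ≠ x i).card :=
        Finset.sum_le_sum_of_subset_of_nonneg hS' fun y _ _ => pow_nonneg hρ _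
    _ = (1 + l * ρ) ^ T - 1 := by
        rw [← sum_pow_card_ne x ρ, ← Finset.add_sum_erase _ _ (Finset.mem_univ x)]
        simp

/-! ### The number of bits -/

/-- A sufficient number of bits, of the order `k log T + k log l`. -/
def sufficientBits (T k l : ℕ) : ℕ :=
  ⌈60 * ((k : ℝ) * Real.logb 2 T + (k : ℝ) * Real.logb 2 l)⌉₊

/-- Rounding up costs at most `1 ≤ k * logb 2 T`, which raises 60 to 61. -/
theorem sufficientBits_le (hT : 2 ≤ T) (hk : 1 ≤ k) (hl : 1 ≤ l) :
    (sufficientBits T k l : ℝ) ≤ 61 * ((k : ℝ) * Real.logb 2 T + (k : ℝ) * Real.logb 2 l) := by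
  have hT' : (2 : ℝ) ≤ T := by exact_mod_cast hT
  have hk' : (1 : ℝ) ≤ k := by exact_mod_cast hk
  have hl' : (1 : ℝ) ≤ l := by exact_mod_cast hl
  have h1 : 1 ≤ Real.logb 2 T := by
    rw [Real.le_logb_iff_rpow_le (by norm_num) (by linarith)]
    simpa using hT'
  have h2 : 0 ≤ Real.logb 2 l := Real.logb_nonneg (by norm_num) hl'
  have h3 : 1 ≤ (k : ℝ) * Real.logb 2 T := by nlinarith
  have h4 : 0 ≤ (k : ℝ) * Real.logb 2 l := by positivity
  have h5 := (Nat.ceil_lt_add_one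
    (a := 60 * ((k : ℝ) * Real.logb 2 T + (k : ℝ) * Real.logb 2 l)) (by linarith)).le
  rw [sufficientBits]
  linarith

theorem log_le_logb_two {x : ℝ} (hx : 1 ≤ x) : Real.log x ≤ Real.logb 2 x := by
  rw [Real.logb, le_div_iff₀ (Real.log_pos (by norm_num))]
  nlinarith [Real.log_nonneg hx, Real.log_two_lt_d9]

/-- The cube comes from `60 = 3 * 20`. The union bound spends one factor `T`, leaving the order
`T⁻²` that an MSE gap of `η/T` calls for. -/
theorem exp_neg_bits_le (hT : 1 ≤ T) (hk : 1 ≤ k) (hl : 1 ≤ l) (hb : sufficientBits T k l ≤ b) :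
    Real.exp (-(b / (20 * k))) ≤ 1 / ((T : ℝ) * l) ^ 3 := by
  have hT' : (1 : ℝ) ≤ T := by exact_mod_cast hT
  have hk' : (1 : ℝ) ≤ k := by exact_mod_cast hk
  have hl' : (1 : ℝ) ≤ l := by exact_mod_cast hl
  have hb' : 60 * ((k : ℝ) * Real.logb 2 T + (k : ℝ) * Real.logb 2 l) ≤ b :=
    (Nat.le_ceil _).trans (by exact_mod_cast hb)
  have hTl : (0 : ℝ) < T * l := by positivity
  have h1 : 3 * Real.log (T * l) ≤ b / (20 * k) := by
    rw [le_div_iff₀ (by positivity), Real.log_mul (by positivity) (by positivity)]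
    have h2 := mul_le_mul_of_nonneg_left (log_le_logb_two hT') (by linarith : (0 : ℝ) ≤ k)
    have h3 := mul_le_mul_of_nonneg_left (log_le_logb_two hl') (by linarith : (0 : ℝ) ≤ k)
    nlinarith
  have h2 : Real.exp (3 * Real.log (T * l)) = ((T : ℝ) * l) ^ 3 := by
    rw [show (3 : ℝ) = (3 : ℕ) by norm_num, Real.exp_nat_mul, Real.exp_log hTl]
  rw [← h2, one_div, ← Real.exp_neg]
  exact Real.exp_le_exp.2 (by linarith)

theorem one_add_mul_exp_pow_sub_one_le (hT : 1 ≤ T) (hk : 1 ≤ k) (hl : 1 ≤ l)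
    (hb : sufficientBits T k l ≤ b) :
    (1 + l * Real.exp (-(b / (20 * k)))) ^ T - 1 ≤ 2 / (T : ℝ) ^ 2 := by
  have hT' : (1 : ℝ) ≤ T := by exact_mod_cast hT
  have hl' : (1 : ℝ) ≤ l := by exact_mod_cast hl
  have hρ := exp_neg_bits_le hT hk hl hb
  have hρ0 := (Real.exp_pos (-((b : ℝ) / (20 * k)))).le
  set ρ := Real.exp (-((b : ℝ) / (20 * k)))
  have h1 : T * (l * ρ) ≤ 1 / (T : ℝ) ^ 2 := by
    calc T * (l * ρ) ≤ T * (l * (1 / ((T : ℝ) * l) ^ 3)) := by gcongr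
      _ = 1 / (T : ℝ) ^ 2 * (1 / (l : ℝ) ^ 2) := by field_simp
      _ ≤ 1 / (T : ℝ) ^ 2 * 1 := by
          gcongr
          rw [div_le_one (by positivity)]
          exact one_le_pow₀ hl'
      _ = _ := mul_one _
  have h2 : T * (l * ρ) ≤ 1 :=
    h1.trans ((div_le_one (by positivity)).2 (one_le_pow₀ hT'))
  have h3 : (1 + l * ρ) ^ T ≤ Real.exp (T * (l * ρ)) := by
    rw [Real.exp_nat_mul]
    exact pow_le_pow_left₀ (by positivity) (by linarith [Real.add_one_le_exp (l * ρ)]) T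
  have h4 : |Real.exp (T * (l * ρ)) - 1| ≤ 2 * |T * (l * ρ)| :=
    Real.abs_exp_sub_one_le (by rwa [abs_of_nonneg (by positivity)])
  rw [abs_of_nonneg (a := T * (l * ρ)) (by positivity)] at h4
  have h5 := (abs_le.1 h4).2
  have h6 : 2 / (T : ℝ) ^ 2 = 2 * (1 / (T : ℝ) ^ 2) := by ring
  linarith

/-! ### The error probability and the mean squared error -/

/-- The inputs (codebook and signal) for which the system does not output the quantized samples. -/
def errorEvent (Q : ScalarQuantizer l) (dec : Codebook T l b → (Fin b → Bool) → Candidate T k l) :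
    Set (Codebook T l b × (Fin T → ℝ)) :=
  {x | ∃ i, output Q dec x.1 x.2 i ≠ Q.quantize (x.2 i)}

theorem encode_congr (Q : ScalarQuantizer l) (cb : Codebook T l b) {s s' : Fin T → ℝ}
    (h : ∀ i, Q.enc (s i) = Q.enc (s' i)) : encode Q cb s = encode Q cb s' := by
  funext r
  rw [Bool.eq_iff_iff, encode_eq_true_iff, encode_eq_true_iff]
  simp only [h]

/-- The system only sees the signal through the quantization indices. -/
theorem exists_output_eq (Q : ScalarQuantizer l)
    (dec : Codebook T l b → (Fin b → Bool) → Candidate T k l) :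
    ∃ F : Codebook T l b × (Fin T → Fin (l + 1)) → Fin T → ℝ,
      ∀ cb s, output Q dec cb s = F (cb, fun i => Q.enc (s i)) := by
  classical
  -- Any signal with the prescribed indices serves as representative; index maps that no signal
  -- attains get the dummy value 0.
  refine ⟨fun p => if h : ∃ s : Fin T → ℝ, (fun i => Q.enc (s i)) = p.2 then
    output Q dec p.1 h.choose else 0, fun cb s => ?_⟩
  have h : ∃ s' : Fin T → ℝ, (fun i => Q.enc (s' i)) = fun i => Q.enc (s i) := ⟨s, rfl⟩
  simp only [dif_pos h, output]
  rw [encode_congr Q cb (congrFun h.choose_spec)]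

/-- `dec` is an arbitrary function, but the output factors through a finite type, on which every map
is measurable. -/
theorem measurable_output (Q : ScalarQuantizer l)
    (dec : Codebook T l b → (Fin b → Bool) → Candidate T k l) (i : Fin T) :
    Measurable fun x : Codebook T l b × (Fin T → ℝ) => output Q dec x.1 x.2 i := by
  obtain ⟨F, hF⟩ := exists_output_eq Q dec
  simp only [hF]
  have h1 : Measurable fun x : Codebook T l b × (Fin T → ℝ) =>
      (x.1, fun i => Q.enc (x.2 i)) :=
    measurable_fst.prodMk (measurable_pi_lambda _ fun i =>
      Q.measurable_enc.comp ((measurable_pi_apply i).comp measurable_snd))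
  have h2 : Measurable fun p => F p i := measurable_of_countable _
  exact h2.comp h1

theorem ScalarQuantizer.measurable_quantize (Q : ScalarQuantizer l) : Measurable Q.quantize :=
  (measurable_of_countable Q.level).comp Q.measurable_enc

theorem measurableSet_errorEvent (Q : ScalarQuantizer l)
    (dec : Codebook T l b → (Fin b → Bool) → Candidate T k l) :
    MeasurableSet (errorEvent Q dec) := by
  have h : errorEvent Q dec = ⋃ i : Fin T,
      {x : Codebook T l b × (Fin T → ℝ) | output Q dec x.1 x.2 i = Q.quantize (x.2 i)}ᶜ := by
    ext x
    simp [errorEvent]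
  rw [h]
  exact MeasurableSet.iUnion fun i => (measurableSet_eq_fun (measurable_output Q dec i)
    (Q.measurable_quantize.comp ((measurable_pi_apply i).comp measurable_snd))).compl

/-- If the error event has conditional probability at most `ε` given the signal, then a function of
the signal has integral at most `ε` times its own integral over the error event. -/
theorem integral_indicator_snd_le {Ω Ω' : Type*} [MeasurableSpace Ω] [MeasurableSpace Ω']
    {ν : Measure Ω} {μ : Measure Ω'} [IsProbabilityMeasure ν] [IsProbabilityMeasure μ]
    {E : Set (Ω × Ω')} (hE : MeasurableSet E) {ε : ℝ}
    (hε : ∀ᵐ s ∂μ, ν.real {c | (c, s) ∈ E} ≤ ε) {H : Ω' → ℝ} (hH : Integrable H μ)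
    (hH0 : ∀ s, 0 ≤ H s) :
    ∫ x, E.indicator (fun x => H x.2) x ∂(ν.prod μ) ≤ ε * ∫ s, H s ∂μ := by
  have hint := (hH.comp_snd ν).indicator hE
  -- Integrating over `c` first, with the signal fixed, makes `H s` a constant factor; no bound on
  -- `H` is needed.
  rw [integral_prod_symm _ hint, ← integral_const_mul]
  refine integral_mono_ae hint.integral_prod_right (hH.const_mul ε) ?_
  filter_upwards [hε] with s hs
  have h1 : (fun c => E.indicator (fun x : Ω × Ω' => H x.2) (c, s)) =
      {c | (c, s) ∈ E}.indicator fun _ => H s := rfl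
  have hEs : MeasurableSet {c | (c, s) ∈ E} := measurable_prodMk_right hE
  rw [h1, integral_indicator_const _ hEs, smul_eq_mul]
  exact mul_le_mul_of_nonneg_right hs (hH0 s)

theorem errorProb_le {Q : ScalarQuantizer l} {μ : Measure (Fin T → ℝ)} [IsProbabilityMeasure μ]
    {dec : Codebook T l b → (Fin b → Bool) → Candidate T k l} {ε : ℝ}
    (hε : ∀ᵐ s ∂μ, (codebookLaw T k l b).real {cb | (cb, s) ∈ errorEvent Q dec} ≤ ε) :
    errorProb Q μ dec ≤ ε := by
  have h := integral_indicator_snd_le (measurableSet_errorEvent Q dec) hε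
    (integrable_const (1 : ℝ)) fun _ => zero_le_one
  rw [integral_indicator_const _ (measurableSet_errorEvent Q dec)] at h
  simpa [errorEvent, errorProb] using h

theorem abs_sub_sq_le {s q A : ℝ} (hq : |q| ≤ A) : |s - q| ^ 2 ≤ 2 * s ^ 2 + 2 * A ^ 2 := by
  rw [sq_abs]
  have := sq_le_sq' (neg_le_of_abs_le hq) (le_of_abs_le hq)
  nlinarith [sq_nonneg (s + q)]

theorem abs_output_le {Q : ScalarQuantizer l} {A : ℝ} (hA : ∀ j, |Q.level j| ≤ A)
    (dec : Codebook T l b → (Fin b → Bool) → Candidate T k l) (cb : Codebook T l b)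
    (s : Fin T → ℝ) (i : Fin T) : |output Q dec cb s i| ≤ A := by
  rw [output, Candidate.reconstruct_apply]
  exact hA _

/-- Both distortions lie between 0 and `H`, a function of the signal alone, and they coincide off
the error event; so their difference is at most `H` times its indicator. -/
theorem abs_systemMSE_sub_scalarMSE_le {Q : ScalarQuantizer l} {μ : Measure (Fin T → ℝ)}
    [IsProbabilityMeasure μ] {A P : ℝ} (hT : 1 ≤ T) (hA : ∀ j, |Q.level j| ≤ A)
    (hint : ∀ i, Integrable (fun s : Fin T → ℝ => s i ^ 2) μ)
    (hP : (1 / (T : ℝ)) * ∑ i, ∫ s, s i ^ 2 ∂μ ≤ P)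
    {dec : Codebook T l b → (Fin b → Bool) → Candidate T k l} {ε : ℝ} (hε0 : 0 ≤ ε)
    (hε : ∀ᵐ s ∂μ, (codebookLaw T k l b).real {cb | (cb, s) ∈ errorEvent Q dec} ≤ ε) :
    |systemMSE Q μ dec - scalarMSE Q μ| ≤ ε * (2 * P + 2 * A ^ 2) := by
  have hT' : (T : ℝ) ≠ 0 := by positivity
  set H : (Fin T → ℝ) → ℝ := fun s => (1 / (T : ℝ)) * ∑ i, (2 * s i ^ 2 + 2 * A ^ 2) with hHdef
  set g : Codebook T l b × (Fin T → ℝ) → ℝ := fun x =>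
    (1 / (T : ℝ)) * ∑ i, |x.2 i - output Q dec x.1 x.2 i| ^ 2 with hg
  set h : (Fin T → ℝ) → ℝ := fun s => (1 / (T : ℝ)) * ∑ i, |s i - Q.quantize (s i)| ^ 2 with hh
  have hsq : ∀ i, Integrable (fun s : Fin T → ℝ => 2 * s i ^ 2 + 2 * A ^ 2) μ := fun i =>
    ((hint i).const_mul 2).add (integrable_const _)
  have hH : Integrable H μ := (integrable_finsetSum _ fun i _ => hsq i).const_mul _
  have hH0 : ∀ s, 0 ≤ H s := fun s => by positivity
  have hgH : ∀ x, g x ≤ H x.2 := fun x => mul_le_mul_of_nonneg_left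
    (Finset.sum_le_sum fun i _ => abs_sub_sq_le (abs_output_le hA dec x.1 x.2 i)) (by positivity)
  have hhH : ∀ s, h s ≤ H s := fun s => mul_le_mul_of_nonneg_left
    (Finset.sum_le_sum fun i _ => abs_sub_sq_le (hA _)) (by positivity)
  have hg0 : ∀ x, 0 ≤ g x := fun x => by positivity
  have hh0 : ∀ s, 0 ≤ h s := fun s => by positivity
  have hgm : Measurable g := by
    refine (Finset.measurable_sum _ fun i _ => ?_).const_mul _
    exact ((((measurable_pi_apply i).comp measurable_snd).sub
      (measurable_output Q dec i)).abs).pow_const 2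
  have hqm : ∀ i, Measurable fun s : Fin T → ℝ => |s i - Q.quantize (s i)| ^ 2 := fun i =>
    (((measurable_pi_apply i).sub
      (Q.measurable_quantize.comp (measurable_pi_apply i))).abs).pow_const 2
  have hqi : ∀ i, Integrable (fun s : Fin T → ℝ => |s i - Q.quantize (s i)| ^ 2) μ := fun i =>
    (hsq i).mono' (hqm i).aestronglyMeasurable (Filter.Eventually.of_forall fun s => by
      rw [Real.norm_of_nonneg (by positivity)]
      exact abs_sub_sq_le (hA _))
  have hhi : Integrable h μ := (integrable_finsetSum _ fun i _ => hqi i).const_mul _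
  have hgi : Integrable g ((codebookLaw T k l b).prod μ) :=
    (hH.comp_snd _).mono' hgm.aestronglyMeasurable (Filter.Eventually.of_forall fun x => by
      rw [Real.norm_of_nonneg (hg0 x)]
      exact hgH x)
  have hscalar : scalarMSE Q μ = ∫ x, h x.2 ∂((codebookLaw T k l b).prod μ) := by
    rw [integral_fun_snd (μ := codebookLaw T k l b) (ν := μ) h, hh, integral_const_mul,
      integral_finsetSum _ fun i _ => hqi i]
    simp [scalarMSE]
  have hHint : ∫ s, H s ∂μ ≤ 2 * P + 2 * A ^ 2 := by
    rw [hHdef, integral_const_mul, integral_finsetSum _ fun i _ => hsq i]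
    have h1 : ∀ i, ∫ s : Fin T → ℝ, (2 * s i ^ 2 + 2 * A ^ 2) ∂μ =
        2 * (∫ s, s i ^ 2 ∂μ) + 2 * A ^ 2 := fun i => by
      rw [integral_add ((hint i).const_mul 2) (integrable_const _), integral_const_mul]
      simp
    have h2 : (1 / (T : ℝ)) * (2 * ∑ i, ∫ s, s i ^ 2 ∂μ + ∑ _i : Fin T, 2 * A ^ 2) =
        2 * ((1 / (T : ℝ)) * ∑ i, ∫ s, s i ^ 2 ∂μ) + 2 * A ^ 2 := by
      simp only [Finset.sum_const, Finset.card_univ, Fintype.card_fin, nsmul_eq_mul]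
      field_simp
    rw [Finset.sum_congr rfl fun i _ => h1 i, Finset.sum_add_distrib, ← Finset.mul_sum, h2]
    linarith
  have hbound : ∀ x, |g x - h x.2| ≤ (errorEvent Q dec).indicator (fun x => H x.2) x := by
    intro x
    by_cases hx : x ∈ errorEvent Q dec
    · rw [Set.indicator_of_mem hx, abs_le]
      constructor <;> linarith [hg0 x, hh0 x.2, hgH x, hhH x.2]
    · rw [Set.indicator_of_notMem hx]
      have h1 : ∀ i, output Q dec x.1 x.2 i = Q.quantize (x.2 i) := by
        simpa [errorEvent] using hx
      simp [hg, hh, h1]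
  have hsys : systemMSE Q μ dec = ∫ x, g x ∂((codebookLaw T k l b).prod μ) := rfl
  rw [hsys, hscalar, ← integral_sub hgi (hhi.comp_snd _)]
  refine abs_integral_le_integral_abs.trans ((integral_mono
    (hgi.sub (hhi.comp_snd _)).abs
    ((hH.comp_snd _).indicator (measurableSet_errorEvent Q dec)) hbound).trans ?_)
  exact (integral_indicator_snd_le (measurableSet_errorEvent Q dec) hε hH hH0).trans
    (mul_le_mul_of_nonneg_left hHint hε0)

end SQuaTS

end

/-- The MSE `D_T(l)` is approached as `T → ∞` by a number of bits
`b(T, k, l) = O(k log T + k log l)`. The threshold `T₀` depends only on the accuracy `η`, on a bound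
`P` on the average power of the signal and on a bound `A` on the quantizer outputs, so the limit is
uniform in `k`, `l`, the quantizer, the law of the sparse signal, the tie-breaking of the decoder,
and any surplus of bits. -/
theorem corollary2 :
    ∃ (C : ℝ) (bits : ℕ → ℕ → ℕ → ℕ),
      (∀ T k l : ℕ, 2 ≤ T → 1 ≤ k → 1 ≤ l →
        (bits T k l : ℝ) ≤ C * ((k : ℝ) * Real.logb 2 T + (k : ℝ) * Real.logb 2 l)) ∧
      ∀ P A η : ℝ, 0 < η → ∃ T₀ : ℕ, ∀ T : ℕ, T₀ ≤ T →
        ∀ k l b : ℕ, 1 ≤ k → k < T → 1 ≤ l → bits T k l ≤ b →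
        ∀ Q : SQuaTS.ScalarQuantizer l, (∀ j, |Q.level j| ≤ A) →
        ∀ μ : MeasureTheory.Measure (Fin T → ℝ), MeasureTheory.IsProbabilityMeasure μ →
          (∀ᵐ s ∂μ, {i | s i ≠ 0}.ncard ≤ k) →
          (∀ i, MeasureTheory.Integrable (fun s => s i ^ 2) μ) →
          (1 / (T : ℝ)) * ∑ i, ∫ s, s i ^ 2 ∂μ ≤ P →
        ∀ dec : SQuaTS.Codebook T l b → (Fin b → Bool) → SQuaTS.Candidate T k l,
          SQuaTS.IsMLDecoder dec →
          SQuaTS.errorProb Q μ dec ≤ η ∧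
          |SQuaTS.systemMSE Q μ dec - SQuaTS.scalarMSE Q μ| ≤ η / T := by
  -- The threshold forces `η * T ≥ 4|P| + 4A² + 2`: the summand 2 serves the error probability
  -- `2/T²`, the rest the MSE gap `(2/T²)(2|P| + 2A²)`. The final `+ 1` ensures `T ≥ 1`.
  refine ⟨61, SQuaTS.sufficientBits, fun T k l => SQuaTS.sufficientBits_le,
    fun P A η hη => ⟨⌈(4 * |P| + 4 * A ^ 2 + 2) / η⌉₊ + 1, fun T hT k l b hk hkT hl hb Q hA μ hμ
      hsparse hint hP dec hdec => ?_⟩⟩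
  have hT1 : 1 ≤ T := by omega
  have hTr : (1 : ℝ) ≤ T := by exact_mod_cast hT1
  have hTη : 4 * |P| + 4 * A ^ 2 + 2 ≤ η * T := by
    have h1 : (4 * |P| + 4 * A ^ 2 + 2) / η ≤ T :=
      (Nat.le_ceil _).trans (by exact_mod_cast (by omega : _ ≤ T))
    rw [div_le_iff₀ hη] at h1
    linarith
  have hε : ∀ᵐ s ∂μ, (SQuaTS.codebookLaw T k l b).real
      {cb | (cb, s) ∈ SQuaTS.errorEvent Q dec} ≤ 2 / (T : ℝ) ^ 2 := by
    filter_upwards [hsparse] with s hs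
    exact (SQuaTS.codebookLaw_real_output_ne_le hk hkT.le Q hdec hs).trans
      (SQuaTS.one_add_mul_exp_pow_sub_one_le hT1 hk hl hb)
  have hP0 := abs_nonneg P
  have hA0 := sq_nonneg A
  refine ⟨(SQuaTS.errorProb_le hε).trans ?_,
    (SQuaTS.abs_systemMSE_sub_scalarMSE_le hT1 hA hint (hP.trans (le_abs_self P))
      (by positivity) hε).trans ?_⟩
  · rw [div_le_iff₀ (by positivity)]
    have : η * T ≤ η * T ^ 2 := by nlinarith [mul_nonneg hη.le (by linarith : (0 : ℝ) ≤ T)]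
    linarith
  · rw [le_div_iff₀ (by positivity)]
    have h1 : 2 / (T : ℝ) ^ 2 * (2 * |P| + 2 * A ^ 2) * T = (4 * |P| + 4 * A ^ 2) / T := by
      field_simp
      ring
    rw [h1, div_le_iff₀ (by positivity)]
    linarith
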